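/- For simplicial sets $A$ and $B$, the wide join $A\diamond B$ is the pushout of $A\sqcup B \leftarrow \partial\Delta^1\times A\times B \to \Delta^1\times A\times B$, where the left-hand map is the projection to $A$ on $\{0\}\times A\times B$ and the projection to $B$ on $\{1\}\times A\times B$, and the right-hand map is the inclusion. It is functorial in $A$ and $B$. A map of simplicial sets is inner anodyne if it has the left lifting property with respect to all inner fibrations, i.e. all maps having the right lifting property with respect to the inner horn inclusions $\Lambda^n_k\subset\Delta^n$, $0<k<n$. Proposition. Let $u\colon A\to B$ and $v\colon C\to D$ be monomorphisms of simplicial sets. If $u$ is inner anodyne, then the canonical map \[ u\diamond' v\colon A\diamond D\cup B\diamond C \to B\diamond D \] is inner anodyne. Here $A\diamond D\cup B\diamond C$ is the pushout of $A\diamond D\leftarrow A\diamond C\to B\diamond C$, which is identified with the union of $A\diamond D$ and $B\diamond C$ inside $B\diamond D$, and $u\diamond' v$ is induced by $u\diamond D$ and $B\diamond v$. -/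

import Mathlib

open CategoryTheory MonoidalCategory Limits Simplicial

universe u

namespace SSet

/-- Every simplex of the boundary `∂Δ[1]` has the same value (`0` or `1`) at all its vertices. -/
lemma boundaryOne_const {n : SimplexCategoryᵒᵖ} (s : (∂Δ[1] : SSet.{u}).obj n)
    (i j : Fin (n.unop.len + 1)) :
    stdSimplex.asOrderHom s.1 i = stdSimplex.asOrderHom s.1 j := by
  have hs : ¬ Function.Surjective (stdSimplex.asOrderHom s.1) := s.2
  by_contra h
  refine hs fun k ↦ ?_
  by_cases hi : stdSimplex.asOrderHom s.1 i = k
  · exact ⟨i, hi⟩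
  · refine ⟨j, ?_⟩
    generalize stdSimplex.asOrderHom s.1 i = a at *
    generalize stdSimplex.asOrderHom s.1 j = b at *
    omega

/-- The map `∂Δ[1] × A × B ⟶ A ⊔ B` given by the projection to `A` on `{0} × A × B`
and by the projection to `B` on `{1} × A × B`. -/
noncomputable def wideJoinEnds (A B : SSet.{u}) :
    (∂Δ[1] : SSet.{u}) ⊗ (A ⊗ B) ⟶ A ⨿ B where
  app n := ↾fun x ↦
    if stdSimplex.asOrderHom x.1.1 0 = 0 then (coprod.inl : A ⟶ A ⨿ B).app n x.2.1
    else (coprod.inr : B ⟶ A ⨿ B).app n x.2.2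
  naturality n m f := by
    ext ⟨s, a, b⟩
    have h : stdSimplex.asOrderHom ((∂Δ[1] : SSet.{u}).map f s).1 0 =
        stdSimplex.asOrderHom s.1 0 :=
      boundaryOne_const s (f.unop.toOrderHom 0) 0
    change (if stdSimplex.asOrderHom ((∂Δ[1] : SSet.{u}).map f s).1 0 = 0
        then (coprod.inl : A ⟶ A ⨿ B).app m (A.map f a)
        else (coprod.inr : B ⟶ A ⨿ B).app m (B.map f b)) =
      (A ⨿ B).map f (if stdSimplex.asOrderHom s.1 0 = 0
        then (coprod.inl : A ⟶ A ⨿ B).app n a else (coprod.inr : B ⟶ A ⨿ B).app n b)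
    rw [h]
    split_ifs
    · exact NatTrans.naturality_apply (coprod.inl : A ⟶ A ⨿ B) f a
    · exact NatTrans.naturality_apply (coprod.inr : B ⟶ A ⨿ B) f b

lemma wideJoinEnds_naturality {A B A' B' : SSet.{u}} (f : A ⟶ A') (g : B ⟶ B') :
    wideJoinEnds A B ≫ coprod.map f g =
      (∂Δ[1] : SSet.{u}) ◁ (f ⊗ₘ g) ≫ wideJoinEnds A' B' := by
  ext n ⟨s, a, b⟩
  change (coprod.map f g).app n (if stdSimplex.asOrderHom s.1 0 = 0
      then (coprod.inl : A ⟶ A ⨿ B).app n a else (coprod.inr : B ⟶ A ⨿ B).app n b) =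
    (if stdSimplex.asOrderHom s.1 0 = 0
      then (coprod.inl : A' ⟶ A' ⨿ B').app n (f.app n a)
      else (coprod.inr : B' ⟶ A' ⨿ B').app n (g.app n b))
  split_ifs
  · exact ConcreteCategory.congr_hom (NatTrans.congr_app (coprod.inl_map f g) n) a
  · exact ConcreteCategory.congr_hom (NatTrans.congr_app (coprod.inr_map f g) n) b

/-- The wide (or fat) join `A ◇ B`: the pushout of
`A ⊔ B ⟵ ∂Δ[1] × A × B ⟶ Δ[1] × A × B`. -/
noncomputable def wideJoin (A B : SSet.{u}) : SSet.{u} :=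
  pushout ((∂Δ[1] : Δ[1].Subcomplex).ι ▷ (A ⊗ B)) (wideJoinEnds A B)

/-- The map `f ◇ g : A ◇ B ⟶ A' ◇ B'` induced by `f : A ⟶ A'` and `g : B ⟶ B'`. -/
noncomputable def wideJoinMap {A B A' B' : SSet.{u}} (f : A ⟶ A') (g : B ⟶ B') :
    wideJoin A B ⟶ wideJoin A' B' :=
  pushout.map _ _ _ _ (Δ[1] ◁ (f ⊗ₘ g)) (coprod.map f g) ((∂Δ[1] : SSet.{u}) ◁ (f ⊗ₘ g))
    rfl (wideJoinEnds_naturality f g)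

/-- The structure map `Δ[1] × A × B ⟶ A ◇ B`. -/
noncomputable def wideJoinCyl (A B : SSet.{u}) : Δ[1] ⊗ (A ⊗ B) ⟶ wideJoin A B :=
  pushout.inl _ _

/-- The structure map `A ⊔ B ⟶ A ◇ B`. -/
noncomputable def wideJoinIncl (A B : SSet.{u}) : A ⨿ B ⟶ wideJoin A B :=
  pushout.inr _ _

lemma wideJoin_isPushout (A B : SSet.{u}) :
    IsPushout ((∂Δ[1] : Δ[1].Subcomplex).ι ▷ (A ⊗ B)) (wideJoinEnds A B)
      (wideJoinCyl A B) (wideJoinIncl A B) :=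
  IsPushout.of_hasPushout _ _

lemma wideJoinCyl_map {A B A' B' : SSet.{u}} (f : A ⟶ A') (g : B ⟶ B') :
    wideJoinCyl A B ≫ wideJoinMap f g = Δ[1] ◁ (f ⊗ₘ g) ≫ wideJoinCyl A' B' :=
  pushout.inl_desc _ _ _

lemma wideJoinIncl_map {A B A' B' : SSet.{u}} (f : A ⟶ A') (g : B ⟶ B') :
    wideJoinIncl A B ≫ wideJoinMap f g = coprod.map f g ≫ wideJoinIncl A' B' :=
  pushout.inr_desc _ _ _

lemma wideJoinMap_comp {A B A' B' A'' B'' : SSet.{u}} (f : A ⟶ A') (g : B ⟶ B')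
    (f' : A' ⟶ A'') (g' : B' ⟶ B'') :
    wideJoinMap f g ≫ wideJoinMap f' g' = wideJoinMap (f ≫ f') (g ≫ g') := by
  apply (wideJoin_isPushout A B).hom_ext
  · rw [← Category.assoc, wideJoinCyl_map, Category.assoc, wideJoinCyl_map, wideJoinCyl_map]
    rfl
  · rw [← Category.assoc, wideJoinIncl_map, Category.assoc, wideJoinIncl_map, wideJoinIncl_map,
      ← Category.assoc, coprod.map_map]

/-- The canonical map `u ◇' v : A ◇ D ∪ B ◇ C ⟶ B ◇ D`, where `A ◇ D ∪ B ◇ C` is the pushout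
of `A ◇ D` and `B ◇ C` along `A ◇ C`. -/
noncomputable def wideJoinCorner {A B C D : SSet.{u}} (u : A ⟶ B) (v : C ⟶ D) :
    pushout (wideJoinMap (𝟙 A) v) (wideJoinMap u (𝟙 C)) ⟶ wideJoin B D :=
  pushout.desc (wideJoinMap u (𝟙 D)) (wideJoinMap (𝟙 B) v) (by simp [wideJoinMap_comp])

end SSet

namespace SSet

/-! The union `A ◇ D ∪ B ◇ C` already contains both ends of `B ◇ D`: `B` lies in `B ◇ C` and `D`
lies in `A ◇ D`. Only the cylinder on the simplices of `B × D` outside `A × D ∪ B × C` is missing,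
and it is attached along its ends and along the cylinder on that union. So the corner map is a
cobase change of the pushout-product of `∂Δ[1] ⟶ Δ[1]` with the pushout-product of `u` and `v`.
Pushout-products of an inner anodyne map with a monomorphism are inner anodyne, so applying this
twice suffices. The cobase change is not constructed: `hasLiftingProperty_wideJoinCorner` transports
lifting problems directly. -/

lemma wideJoinEnds_incl {A B : SSet.{u}} :
    wideJoinEnds A B ≫ wideJoinIncl A B =
      ((∂Δ[1] : Δ[1].Subcomplex).ι ▷ (A ⊗ B)) ≫ wideJoinCyl A B :=
  (wideJoin_isPushout A B).w.symm

lemma isPushout_whiskerLeft (K : SSet.{u}) {W X Y Z : SSet.{u}} {f : W ⟶ X} {g : W ⟶ Y}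
    {h : X ⟶ Z} {k : Y ⟶ Z} (sq : IsPushout f g h k) :
    IsPushout (K ◁ f) (K ◁ g) (K ◁ h) (K ◁ k) :=
  sq.map (tensorLeft K)

/-- The lifting property of the corner map of the wide join reduces to that of the
pushout-product of `∂Δ[1] ⟶ Δ[1]` with the pushout-product of `u` and `v`. -/
lemma hasLiftingProperty_wideJoinCorner {A B C D X Y : SSet.{u}} (u : A ⟶ B) (v : C ⟶ D)
    (p : X ⟶ Y) (sq : (curriedTensor SSet.{u}).PushoutObjObj u v)
    (sq' : (curriedTensor SSet.{u}).PushoutObjObj (∂Δ[1] : Δ[1].Subcomplex).ι sq.ι)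
    [HasLiftingProperty sq'.ι p] :
    HasLiftingProperty (wideJoinCorner u v) p where
  sq_hasLift {t b} comm := by
    let tl : wideJoin A D ⟶ X := pushout.inl _ _ ≫ t
    let tr : wideJoin B C ⟶ X := pushout.inr _ _ ≫ t
    have ht : wideJoinMap (𝟙 A) v ≫ tl = wideJoinMap u (𝟙 C) ≫ tr := pushout.condition_assoc _
    have hl : wideJoinMap u (𝟙 D) ≫ b = tl ≫ p := by
      rw [Category.assoc, comm.w, wideJoinCorner, pushout.inl_desc_assoc]
    have hr : wideJoinMap (𝟙 B) v ≫ b = tr ≫ p := by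
      rw [Category.assoc, comm.w, wideJoinCorner, pushout.inr_desc_assoc]
    -- The lift is forced on the ends: each of `B` and `D` lies in one of the two pieces where the
    -- map to `X` is given.
    let e : B ⨿ D ⟶ X := coprod.desc (coprod.inl ≫ wideJoinIncl B C ≫ tr)
      (coprod.inr ≫ wideJoinIncl A D ≫ tl)
    have hei : coprod.inl ≫ e = coprod.inl ≫ wideJoinIncl B C ≫ tr := coprod.inl_desc _ _
    have hej : coprod.inr ≫ e = coprod.inr ≫ wideJoinIncl A D ≫ tl := coprod.inr_desc _ _
    -- `A` and `C` lie in `A ◇ C`, where `tl` and `tr` agree; this makes `e` compatible with both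
    -- pieces.
    have hinc : coprod.map (𝟙 A) v ≫ wideJoinIncl A D ≫ tl =
        coprod.map u (𝟙 C) ≫ wideJoinIncl B C ≫ tr := by
      rw [← reassoc_of% (wideJoinIncl_map (𝟙 A) v), ← reassoc_of% (wideJoinIncl_map u (𝟙 C)), ht]
    have hel : coprod.map u (𝟙 D) ≫ e = wideJoinIncl A D ≫ tl := by
      ext1
      · simpa [hei] using (coprod.inl ≫= hinc).symm
      · simp [hej]
    have her : coprod.map (𝟙 B) v ≫ e = wideJoinIncl B C ≫ tr := by
      ext1
      · simp [hei]
      · simpa [hej] using coprod.inr ≫= hinc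
    have hep : e ≫ p = wideJoinIncl B D ≫ b := by
      ext1
      · have := coprod.inl ≫= wideJoinIncl B C ≫= hr
        rw [reassoc_of% (wideJoinIncl_map (𝟙 B) v)] at this
        simpa [reassoc_of% hei] using this.symm
      · have := coprod.inr ≫= wideJoinIncl A D ≫= hl
        rw [reassoc_of% (wideJoinIncl_map u (𝟙 D))] at this
        simpa [reassoc_of% hej] using this.symm
    have hinl : sq.inl ≫ sq.ι = 𝟙 B ⊗ₘ v := by simp
    have hinr : sq.inr ≫ sq.ι = u ⊗ₘ 𝟙 D := by simp
    -- `Δ[1] ⊗ -` preserves the pushout `sq.pt`, so the cylinders on `B ⊗ C` and `A ⊗ D` glue.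
    let c : Δ[1] ⊗ sq.pt ⟶ X := (isPushout_whiskerLeft Δ[1] sq.isPushout).desc
      (wideJoinCyl B C ≫ tr) (wideJoinCyl A D ≫ tl) (by
        have h₁ := wideJoinCyl_map (𝟙 A) v
        have h₂ := wideJoinCyl_map u (𝟙 C)
        have h₃ := wideJoinCyl A C ≫= ht
        rw [reassoc_of% h₁, reassoc_of% h₂] at h₃
        simpa using h₃.symm)
    have hcl : Δ[1] ◁ sq.inl ≫ c = wideJoinCyl B C ≫ tr := IsPushout.inl_desc _ _ _ _
    have hcr : Δ[1] ◁ sq.inr ≫ c = wideJoinCyl A D ≫ tl := IsPushout.inr_desc _ _ _ _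
    -- The top map of the transported lifting problem: `c` on the cylinder over `sq.pt`, and `e` on
    -- the ends of the cylinder over `B ⊗ D`.
    let s : sq'.pt ⟶ X := sq'.isPushout.desc c (wideJoinEnds B D ≫ e) (by
      apply (isPushout_whiskerLeft (∂Δ[1] : SSet.{u}) sq.isPushout).hom_ext
      · change _ ◁ sq.inl ≫ _ ▷ sq.pt ≫ c = _ ◁ sq.inl ≫ _ ◁ sq.ι ≫ _
        rw [whisker_exchange_assoc, hcl, ← whiskerLeft_comp_assoc, hinl,
          ← reassoc_of% (wideJoinEnds_naturality (𝟙 B) v), her, reassoc_of% wideJoinEnds_incl]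
        rfl
      · change _ ◁ sq.inr ≫ _ ▷ sq.pt ≫ c = _ ◁ sq.inr ≫ _ ◁ sq.ι ≫ _
        rw [whisker_exchange_assoc, hcr, ← whiskerLeft_comp_assoc, hinr,
          ← reassoc_of% (wideJoinEnds_naturality u (𝟙 D)), hel, reassoc_of% wideJoinEnds_incl]
        rfl)
    have hsl : sq'.inl ≫ s = c := sq'.isPushout.inl_desc _ _ _
    have hsr : sq'.inr ≫ s = wideJoinEnds B D ≫ e := sq'.isPushout.inr_desc _ _ _
    have hil : sq'.inl ≫ sq'.ι = Δ[1] ◁ sq.ι := sq'.inl_ι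
    have hir : sq'.inr ≫ sq'.ι = (∂Δ[1] : Δ[1].Subcomplex).ι ▷ (B ⊗ D) := sq'.inr_ι
    have hs : CommSq s sq'.ι p (wideJoinCyl B D ≫ b) := ⟨by
      apply sq'.hom_ext
      · rw [reassoc_of% hsl, reassoc_of% hil]
        apply (isPushout_whiskerLeft Δ[1] sq.isPushout).hom_ext
        · rw [reassoc_of% hcl, ← hr, ← whiskerLeft_comp_assoc, hinl,
            ← reassoc_of% (wideJoinCyl_map (𝟙 B) v)]
        · rw [reassoc_of% hcr, ← hl, ← whiskerLeft_comp_assoc, hinr,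
            ← reassoc_of% (wideJoinCyl_map u (𝟙 D))]
      · rw [reassoc_of% hsr, reassoc_of% hir, hep, reassoc_of% wideJoinEnds_incl]⟩
    have hlift : Δ[1] ◁ sq.ι ≫ hs.lift = c := by
      rw [← hil, Category.assoc, hs.fac_left, hsl]
    -- The lift on the cylinder restricts to `e` on its ends, so it descends to the wide join.
    let l : wideJoin B D ⟶ X := (wideJoin_isPushout B D).desc hs.lift e (by
      rw [← hir, Category.assoc, hs.fac_left, hsr])
    have hlc : wideJoinCyl B D ≫ l = hs.lift := (wideJoin_isPushout B D).inl_desc _ _ _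
    have hli : wideJoinIncl B D ≫ l = e := (wideJoin_isPushout B D).inr_desc _ _ _
    refine ⟨⟨⟨l, ?_, ?_⟩⟩⟩
    · apply pushout.hom_ext
      · simp only [wideJoinCorner, pushout.inl_desc_assoc]
        apply (wideJoin_isPushout A D).hom_ext
        · rw [reassoc_of% (wideJoinCyl_map u (𝟙 D)), hlc, ← hinr, whiskerLeft_comp_assoc,
            hlift, hcr]
        · rw [reassoc_of% (wideJoinIncl_map u (𝟙 D)), hli, hel]
      · simp only [wideJoinCorner, pushout.inr_desc_assoc]
        apply (wideJoin_isPushout B C).hom_ext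
        · rw [reassoc_of% (wideJoinCyl_map (𝟙 B) v), hlc, ← hinl, whiskerLeft_comp_assoc,
            hlift, hcl]
        · rw [reassoc_of% (wideJoinIncl_map (𝟙 B) v), hli, her]
    · apply (wideJoin_isPushout B D).hom_ext
      · rw [reassoc_of% hlc, hs.fac_right]
      · rw [reassoc_of% hli, hep]

end SSet

theorem mainTheorem5 {A B C D : SSet.{u}} (u : A ⟶ B) (v : C ⟶ D) [Mono u] [Mono v]
    (hu : SSet.innerAnodyneExtensions u) :
    SSet.innerAnodyneExtensions (SSet.wideJoinCorner u v) := by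
  intro X Y p hp
  let sq := Functor.PushoutObjObj.ofHasPushout (curriedTensor SSet.{u}) u v
  let sq' := Functor.PushoutObjObj.ofHasPushout (curriedTensor SSet.{u})
    (∂Δ[1] : SSet.Subcomplex.{u} Δ[1]).ι sq.ι
  have : HasLiftingProperty sq'.ι p :=
    -- The inner anodyne factor is now the second one, `sq.ι`; the boundary inclusion is the
    -- monomorphism.
    SSet.innerAnodyneExtensions_pushoutObjObjι sq'
      (SSet.innerAnodyneExtensions_pushoutObjObjι' sq hu) p hp
  exact SSet.hasLiftingProperty_wideJoinCorner u v p sq sq'
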